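/- **Setting.** Client $i\in\{1,\dots,n\}$ holds $s_i$ samples; $nm=\sum_i s_i\ge 1$ is the total number of samples and $m=\frac1n\sum_i s_i$ the average local size. All samples are independent, those of client $i$ being drawn from a distribution $\mathcal D_i$; $\mathcal D=\sum_i \frac{s_i}{nm}\mathcal D_i$ is the global distribution (if all $\mathcal D_i$ coincide, the data are i.i.d. from $\mathcal D$). Let $F:\mathbb R^d\times\mathcal Z\to[0,1]$ be a measurable loss. For a probability measure $Q$ on $\mathbb R^d$ put $$R(Q)=\mathbb E_{\theta\sim Q}\,\mathbb E_{\xi\sim\mathcal D}F(\theta;\xi),\qquad \hat R(Q)=\mathbb E_{\theta\sim Q}\,\frac1{nm}\sum_{i=1}^n\sum_{j=1}^{s_i}F(\theta;\zeta_{i,j}),$$ where $\zeta_{i,j}$ are the training samples. **Ornstein–Uhlenbeck model of federated SGD.** Fix $\theta^*\in\mathbb R^d$ (the minimum, not depending on the data), a number of rounds $T\ge1$, a learning rate $\eta>0$ and a local batch size $k_{Fed}m$ with $\frac1m\le k_{Fed}\le1$. Given the training set, let client $i$ have local Hessian $A_i\in\mathbb R^{d\times d}$ (symmetric positive semidefinite)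 and gradient noise covariance $C_i=B_iB_i^\top$; that is, near $\theta^*$ its stochastic gradient is modeled as $A_i(\theta-\theta^*)$ plus Gaussian noise of covariance $C_i/(k_{Fed}m)$. The matrices $A_i,B_i$ may depend on the training set in any way. Put $\bar A=\frac1n\sum_iA_i$, $\bar B=\frac1n\sum_iB_i$, $\bar C=\bar B\bar B^\top$, and assume that $\bar A$ is invertible. FedAvg is modeled by the Ornstein–Uhlenbeck process $$\theta(t)=\theta^*+e^{-T\bar At}(\theta(0)-\theta^*)+T\sqrt{\tfrac{\eta}{k_{Fed}m}}\int_0^t e^{-T\bar A(t-t')}\bar B\,dW(t'),$$ with $W$ a standard Brownian motion independent of $\theta(0)$. The output distribution $Q_{Fed}$ is a stationary distribution of this process, and $\Sigma_{Fed}$, its covariance matrix, is assumed to be nonsingular. (The assumptions on $\bar A$, $A_i$, $Q_{Fed}$ and $\Sigma_{Fed}$ are only needed for almost every training set.) **Theorem.** For every $\delta\in(0,1)$, with probability at least $1-\delta$ over the distributed training set of total size $nm$, $$R(Q_{Fed})-\hat R(Q_{Fed})\le\sqrt{\frac{-\log\det\Sigma_{Fed}+\frac{T\eta}{2k_{Fed}m}\operatorname{tr}(\bar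 C\bar A^{-1})-d+2\log\frac1\delta+2\log(nm)+4}{4nm-2}}.$$ -/

import Mathlib

open MeasureTheory ProbabilityTheory

noncomputable section

namespace FedPAC

/-! ### Distributed data and risks -/

/-- A distributed training set: client `i` holds `s i` samples. -/
abbrev Dataset {n : ℕ} (s : Fin n → ℕ) (Z : Type*) : Type _ :=
  (i : Fin n) → Fin (s i) → Z

/-- Total number of samples over all clients (written `nm`). -/
def totalSize {n : ℕ} (s : Fin n → ℕ) : ℕ := ∑ i, s i

/-- Average local data set size `m`. -/
def avgSize {n : ℕ} (s : Fin n → ℕ) : ℝ := (∑ i, (s i : ℝ)) / n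

/-- Law of the distributed training set: all samples are independent, and those of client `i`
are drawn from the distribution `D i` of that client. -/
def dataLaw {n : ℕ} (s : Fin n → ℕ) {Z : Type*} [MeasurableSpace Z] (D : Fin n → Measure Z) :
    Measure (Dataset s Z) :=
  Measure.pi fun i => Measure.pi fun _ : Fin (s i) => D i

/-- The global data distribution: the mixture of the client distributions, client `i` having
weight `s i / nm`. If all clients share one distribution, this is that distribution. -/
def globalLaw {n : ℕ} (s : Fin n → ℕ) {Z : Type*} [MeasurableSpace Z] (D : Fin n → Measure Z) :
    Measure Z :=
  ∑ i, ((s i : ENNReal) / (totalSize s : ENNReal)) • D i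

/-- Expected risk `E_{θ ∼ Q} E_{ξ ∼ D} F(θ; ξ)`. -/
def risk {d : ℕ} {Z : Type*} [MeasurableSpace Z] (F : EuclideanSpace ℝ (Fin d) → Z → ℝ)
    (D : Measure Z) (Q : Measure (EuclideanSpace ℝ (Fin d))) : ℝ :=
  ∫ θ, ∫ ξ, F θ ξ ∂D ∂Q

/-- Empirical risk: the expectation over `θ ∼ Q` of the average loss over all samples. -/
def empRisk {d n : ℕ} {s : Fin n → ℕ} {Z : Type*} (F : EuclideanSpace ℝ (Fin d) → Z → ℝ)
    (S : Dataset s Z) (Q : Measure (EuclideanSpace ℝ (Fin d))) : ℝ :=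
  ∫ θ, (∑ i, ∑ j, F θ (S i j)) / (totalSize s : ℝ) ∂Q

/-! ### Ornstein–Uhlenbeck processes -/

/-- Covariance matrix of `∫₀ᵗ exp (-(t - u) A) G dW(u)`, `W` a standard Brownian motion. -/
def ouNoiseCov {d : ℕ} (A G : Matrix (Fin d) (Fin d) ℝ) (t : ℝ) : Matrix (Fin d) (Fin d) ℝ :=
  Matrix.of fun i j => ∫ u in (0 : ℝ)..t,
    (NormedSpace.exp (-(t - u) • A) * (G * G.transpose) *
      (NormedSpace.exp (-(t - u) • A)).transpose) i j

/-- Law at time `t` of the solution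
`θ(t) = c + exp (-t A) (θ(0) - c) + ∫₀ᵗ exp (-(t - u) A) G dW(u)` of the linear stochastic
differential equation `dθ = -A (θ - c) dt + G dW`, when `θ(0)` has law `Q` and is independent of
the Brownian motion `W` (the stochastic integral is a centred Gaussian vector). -/
def ouLaw {d : ℕ} (c : EuclideanSpace ℝ (Fin d)) (A G : Matrix (Fin d) (Fin d) ℝ)
    (Q : Measure (EuclideanSpace ℝ (Fin d))) (t : ℝ) : Measure (EuclideanSpace ℝ (Fin d)) :=
  (Q.prod (multivariateGaussian 0 (ouNoiseCov A G t))).map fun p =>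
    c + Matrix.toEuclideanCLM (𝕜 := ℝ) (NormedSpace.exp (-t • A)) (p.1 - c) + p.2

/-- `Q` is a stationary distribution of `dθ = -A (θ - c) dt + G dW`. -/
def IsOUStationary {d : ℕ} (c : EuclideanSpace ℝ (Fin d)) (A G : Matrix (Fin d) (Fin d) ℝ)
    (Q : Measure (EuclideanSpace ℝ (Fin d))) : Prop :=
  IsProbabilityMeasure Q ∧ ∀ t : ℝ, 0 ≤ t → ouLaw c A G Q t = Q

/-- Covariance matrix of a distribution on parameter space. -/
def covMat {d : ℕ} (Q : Measure (EuclideanSpace ℝ (Fin d))) : Matrix (Fin d) (Fin d) ℝ :=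
  Matrix.of fun i j => covariance (fun θ => θ i) (fun θ => θ j) Q

/-! ### The Ornstein–Uhlenbeck model of federated SGD

Near the minimum `θ*`, client `i` has the linearised gradient `A i (θ - θ*)`, and its stochastic
gradient on a batch of size `k m` is this gradient plus Gaussian noise of covariance
`(B i) (B i)ᵀ / (k m)`. -/

/-- Average over the clients, `(1/n) ∑ i, X i`. -/
def clientAvg {n d : ℕ} (X : Fin n → Matrix (Fin d) (Fin d) ℝ) : Matrix (Fin d) (Fin d) ℝ :=
  (1 / (n : ℝ)) • ∑ i, X i

/-- The averaged noise covariance `C̄ = B̄ B̄ᵀ`, with `B̄` the average of the noise factors. -/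
def avgNoiseCov {n d : ℕ} (B : Fin n → Matrix (Fin d) (Fin d) ℝ) : Matrix (Fin d) (Fin d) ℝ :=
  clientAvg B * (clientAvg B).transpose

/-- `Q` is a stationary distribution of the federated SGD process with `T` rounds, learning rate
`η` and batch size `k m`, that is, of
`θ(t) = θ* + exp (-T Ā t) (θ(0) - θ*) + T √(η/(k m)) ∫₀ᵗ exp (-T Ā (t - u)) B̄ dW(u)`. -/
def IsFedStationary {n d : ℕ} (θstar : EuclideanSpace ℝ (Fin d)) (T : ℕ) (η k m : ℝ)
    (A B : Fin n → Matrix (Fin d) (Fin d) ℝ) (Q : Measure (EuclideanSpace ℝ (Fin d))) : Prop :=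
  IsOUStationary θstar ((T : ℝ) • clientAvg A)
    (((T : ℝ) * Real.sqrt (η / (k * m))) • clientAvg B) Q

end FedPAC

end

/-! This is a PAC-Bayes argument with the data-independent Gaussian prior P = N(θ*, I), applied to a
posterior that turns out to be Gaussian with the same mean. Write N for the total sample size.

For fixed θ the gap is a sum of N independent, centred, bounded terms, hence sub-Gaussian with
variance proxy 1/(4N) (`hasSubgaussianMGF_gap`). So exp((2N - 1) gap²) has expectation at most
√(2N), also after averaging over P, and by Markov's inequality the P-average is at most √(2N)/δ with
probability at least 1 - δ (`exists_measurableSet_lintegral_exp_gap_le`). This event does not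
involve the posterior, which may therefore depend on the data arbitrarily.

Letting t → ∞ in the stationarity equation for characteristic functions identifies the output law as
N(θ*, Σ) with tr Σ = Tη/(2km) tr(C̄ Ā⁻¹) (`IsOUStationary.exists_eq_multivariateGaussian`). Its
divergence from P is (tr Σ - d - log det Σ)/2, and the Donsker–Varadhan inequality
(`integral_multivariateGaussian_le`) transfers the exponential moment bound under P to a bound on
the mean of (2N - 1) gap² under N(θ*, Σ). Jensen's inequality for the square then bounds the mean
gap. -/

namespace FedPAC

/-! ### Exponential moments of the generalization gap -/

/-- A sum of functions of the separate coordinates of a product space is sub-Gaussian if each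
summand is. -/
lemma hasSubgaussianMGF_sum_pi {ι : Type*} [Fintype ι] {Ω : ι → Type*}
    [∀ i, MeasurableSpace (Ω i)] {μ : (i : ι) → Measure (Ω i)} [∀ i, IsProbabilityMeasure (μ i)]
    {X : (i : ι) → Ω i → ℝ} {c : ι → NNReal} (hX : ∀ i, HasSubgaussianMGF (X i) (c i) (μ i)) :
    HasSubgaussianMGF (fun ω => ∑ i, X i (ω i)) (∑ i, c i) (Measure.pi μ) := by
  refine HasSubgaussianMGF.sum_of_iIndepFun (iIndepFun_pi fun i => (hX i).aemeasurable)
    fun i _ => ?_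
  have h : HasSubgaussianMGF (X i) (c i) ((Measure.pi μ).map (Function.eval i)) := by
    rw [(measurePreserving_eval μ i).map_eq]
    exact hX i
  exact h.of_map (measurable_pi_apply i).aemeasurable

/-- The Gaussian density absorbs the factor, leaving a Gaussian integral of rate 1/2 - a, which is
positive by `ha`. -/
lemma lintegral_exp_mul_sq_gaussianReal {a : ℝ} (ha : 2 * a < 1) :
    ∫⁻ x, ENNReal.ofReal (Real.exp (a * x ^ 2)) ∂(gaussianReal 0 1) =
      ENNReal.ofReal (1 / Real.sqrt (1 - 2 * a)) := by
  have hb : 0 < 1 / 2 - a := by linarith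
  have key : ∀ x : ℝ, gaussianPDF 0 1 x * ENNReal.ofReal (Real.exp (a * x ^ 2)) =
      ENNReal.ofReal ((Real.sqrt (2 * Real.pi))⁻¹ * Real.exp (-(1 / 2 - a) * x ^ 2)) := by
    intro x
    rw [gaussianPDF, ← ENNReal.ofReal_mul (gaussianPDFReal_nonneg _ _ _), gaussianPDFReal_def,
      mul_assoc, ← Real.exp_add]
    congr 2
    · simp
    · congr 1
      simp
      ring
  rw [gaussianReal_of_var_ne_zero _ one_ne_zero,
    lintegral_withDensity_eq_lintegral_mul _ (measurable_gaussianPDF _ _) (by fun_prop)]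
  simp only [Pi.mul_apply, key]
  rw [← ofReal_integral_eq_lintegral_ofReal
    ((integrable_exp_neg_mul_sq hb).const_mul _) (ae_of_all _ fun x => by positivity),
    integral_const_mul, integral_gaussian, ← Real.sqrt_inv, ← Real.sqrt_mul (by positivity),
    one_div (Real.sqrt _), ← Real.sqrt_inv]
  congr 2
  have : 1 - 2 * a ≠ 0 := by linarith
  have : 1 / 2 - a ≠ 0 := hb.ne'
  field_simp

/-- Exponential moment of the square of a sub-Gaussian random variable, by Gaussian
linearization. -/
lemma lintegral_exp_mul_sq_le {Ω : Type*} [MeasurableSpace Ω] {μ : Measure Ω}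
    [SFinite μ] {X : Ω → ℝ} {v : NNReal} (hX : HasSubgaussianMGF X v μ) {c : ℝ} (hc : 0 ≤ c)
    (hcv : 2 * (c * v) < 1) :
    ∫⁻ ω, ENNReal.ofReal (Real.exp (c * X ω ^ 2)) ∂μ ≤
      ENNReal.ofReal (1 / Real.sqrt (1 - 2 * (c * v))) := by
  -- The Gaussian moment generating function exp(t²/2) at t = √(2c) y turns the square into a linear
  -- exponent, to which the sub-Gaussian bound applies for each fixed g.
  have hlin : ∀ y : ℝ, ENNReal.ofReal (Real.exp (c * y ^ 2)) =
      ∫⁻ g, ENNReal.ofReal (Real.exp (Real.sqrt (2 * c) * y * g)) ∂(gaussianReal 0 1) := by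
    intro y
    rw [← ofReal_integral_eq_lintegral_ofReal (integrable_exp_mul_gaussianReal _)
      (ae_of_all _ fun x => by positivity)]
    have := mgf_gaussianReal (p := gaussianReal 0 1) (X := id) (μ := 0) (v := 1)
      (by simp) (Real.sqrt (2 * c) * y)
    simp only [mgf, id] at this
    rw [this, mul_pow, Real.sq_sqrt (by positivity)]
    congr 2
    simp
    ring
  simp_rw [hlin]
  rw [lintegral_lintegral_swap]
  · rw [← lintegral_exp_mul_sq_gaussianReal hcv]
    refine lintegral_mono fun g => ?_
    have h1 := hX.integrable_exp_mul (Real.sqrt (2 * c) * g)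
    have h2 := hX.mgf_le (Real.sqrt (2 * c) * g)
    rw [mul_pow, Real.sq_sqrt (by positivity), mgf] at h2
    calc ∫⁻ ω, ENNReal.ofReal (Real.exp (Real.sqrt (2 * c) * X ω * g)) ∂μ
        = ∫⁻ ω, ENNReal.ofReal (Real.exp (Real.sqrt (2 * c) * g * X ω)) ∂μ := by
          simp_rw [mul_right_comm]
      _ = ENNReal.ofReal (∫ ω, Real.exp (Real.sqrt (2 * c) * g * X ω) ∂μ) :=
          (ofReal_integral_eq_lintegral_ofReal h1 (ae_of_all _ fun x => by positivity)).symm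
      _ ≤ _ := ENNReal.ofReal_le_ofReal (h2.trans_eq (by congr 1; ring))
  · have := hX.aemeasurable.comp_fst (ν := gaussianReal 0 1)
    simp only [Function.uncurry_def]
    exact ENNReal.measurable_ofReal.comp_aemeasurable
      (Real.measurable_exp.comp_aemeasurable ((this.const_mul _).mul measurable_snd.aemeasurable))

/-! ### The generalization gap of a fixed parameter -/

section Gap

variable {n d : ℕ} {s : Fin n → ℕ} {Z : Type*} [MeasurableSpace Z]

/-- The generalization gap of the parameter `θ`. -/
noncomputable def gap (F : EuclideanSpace ℝ (Fin d) → Z → ℝ) (D : Fin n → Measure Z)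
    (θ : EuclideanSpace ℝ (Fin d)) (S : Dataset s Z) : ℝ :=
  ∫ ξ, F θ ξ ∂(globalLaw s D) - (∑ i, ∑ j, F θ (S i j)) / (totalSize s : ℝ)

lemma isProbabilityMeasure_globalLaw (hs : 0 < totalSize s) {D : Fin n → Measure Z}
    (hD : ∀ i, IsProbabilityMeasure (D i)) : IsProbabilityMeasure (globalLaw s D) := by
  constructor
  have h0 : (totalSize s : ENNReal) ≠ 0 := by exact_mod_cast hs.ne'
  simp only [globalLaw, Measure.coe_finsetSum, Finset.sum_apply, Measure.smul_apply,
    measure_univ, smul_eq_mul, mul_one, div_eq_mul_inv]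
  rw [← Finset.sum_mul, ← Nat.cast_sum]
  exact ENNReal.mul_inv_cancel h0 (ENNReal.natCast_ne_top _)

variable {F : EuclideanSpace ℝ (Fin d) → Z → ℝ} {D : Fin n → Measure Z}

/-- The mixture weights give every sample weight 1/N, so the gap is an average of terms centred at
their own client's mean, even when the clients differ. -/
lemma integral_globalLaw (hF : Measurable (Function.uncurry F))
    (hF01 : ∀ θ z, F θ z ∈ Set.Icc (0 : ℝ) 1) (hD : ∀ i, IsProbabilityMeasure (D i))
    (θ : EuclideanSpace ℝ (Fin d)) :
    ∫ ξ, F θ ξ ∂(globalLaw s D) = (∑ i, ∑ _j : Fin (s i), ∫ ξ, F θ ξ ∂(D i)) / totalSize s := by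
  have hm : Measurable (F θ) := hF.of_uncurry_left
  rcases Nat.eq_zero_or_pos (totalSize s) with h | hs
  -- Without samples every weight is `0 / 0 = 0`, and both sides vanish.
  · have : ∀ i, s i = 0 := by simpa [totalSize] using h
    simp [globalLaw, this, h]
  have h0 : (totalSize s : ENNReal) ≠ 0 := by exact_mod_cast hs.ne'
  rw [globalLaw, integral_finsetSum_measure]
  · simp only [integral_smul_measure, Finset.sum_const, Finset.card_univ, Fintype.card_fin,
      ENNReal.toReal_div, ENNReal.toReal_natCast, smul_eq_mul, nsmul_eq_mul, Finset.sum_div]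
    exact Finset.sum_congr rfl fun i _ => by ring
  · intro i _
    refine Integrable.smul_measure ?_ (ENNReal.div_lt_top (by simp) h0).ne
    exact Integrable.of_mem_Icc 0 1 hm.aemeasurable (ae_of_all _ fun z => hF01 θ z)

lemma gap_mem_Icc (hF : Measurable (Function.uncurry F))
    (hF01 : ∀ θ z, F θ z ∈ Set.Icc (0 : ℝ) 1) (hD : ∀ i, IsProbabilityMeasure (D i))
    (hs : 0 < totalSize s) (θ : EuclideanSpace ℝ (Fin d)) (S : Dataset s Z) :
    gap F D θ S ∈ Set.Icc (-1 : ℝ) 1 := by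
  have hN : (0 : ℝ) < totalSize s := by exact_mod_cast hs
  have := isProbabilityMeasure_globalLaw hs hD
  have hm : Measurable (F θ) := hF.of_uncurry_left
  have h1 : 0 ≤ ∫ ξ, F θ ξ ∂(globalLaw s D) := integral_nonneg fun z => (hF01 θ z).1
  have h2 : ∫ ξ, F θ ξ ∂(globalLaw s D) ≤ 1 := by
    refine (integral_mono (Integrable.of_mem_Icc 0 1 hm.aemeasurable
      (ae_of_all _ fun z => hF01 θ z)) (integrable_const 1) fun z => (hF01 θ z).2).trans ?_
    simp
  have h3 : 0 ≤ (∑ i, ∑ j, F θ (S i j)) / (totalSize s : ℝ) :=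
    div_nonneg (Finset.sum_nonneg fun i _ => Finset.sum_nonneg fun j _ => (hF01 _ _).1) hN.le
  have h4 : (∑ i, ∑ j, F θ (S i j)) / (totalSize s : ℝ) ≤ 1 := by
    rw [div_le_one hN]
    calc ∑ i, ∑ j, F θ (S i j) ≤ ∑ i, ∑ _j : Fin (s i), (1 : ℝ) :=
          Finset.sum_le_sum fun i _ => Finset.sum_le_sum fun j _ => (hF01 _ _).2
      _ = totalSize s := by simp [totalSize]
  rw [gap]
  constructor <;> linarith

lemma measurable_gap (hF : Measurable (Function.uncurry F)) (hs : 0 < totalSize s)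
    (hD : ∀ i, IsProbabilityMeasure (D i)) :
    Measurable fun p : Dataset s Z × EuclideanSpace ℝ (Fin d) => gap F D p.2 p.1 := by
  have := isProbabilityMeasure_globalLaw hs hD
  have h1 : Measurable fun θ => ∫ ξ, F θ ξ ∂(globalLaw s D) :=
    (StronglyMeasurable.integral_prod_right (f := F)
      hF.stronglyMeasurable).measurable
  have h2 : ∀ i j, Measurable fun p : Dataset s Z × EuclideanSpace ℝ (Fin d) =>
      F p.2 (p.1 i j) := fun i j =>
    hF.comp (measurable_snd.prodMk
      ((measurable_pi_apply j).comp ((measurable_pi_apply i).comp measurable_fst)))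
  exact (h1.comp measurable_snd).sub ((Finset.measurable_sum _ fun i _ =>
    Finset.measurable_sum _ fun j _ => h2 i j).div_const _)

/-- Hoeffding's lemma gives proxy 1/4 per sample; N independent samples give N/4, and scaling by
-1/N gives 1/(4N). -/
lemma hasSubgaussianMGF_gap (hF : Measurable (Function.uncurry F))
    (hF01 : ∀ θ z, F θ z ∈ Set.Icc (0 : ℝ) 1) (hD : ∀ i, IsProbabilityMeasure (D i))
    (hs : 0 < totalSize s) (θ : EuclideanSpace ℝ (Fin d)) :
    HasSubgaussianMGF (gap F D θ) (1 / (4 * totalSize s)) (dataLaw s D) := by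
  have hm : Measurable (F θ) := hF.of_uncurry_left
  have h1 : ∀ i, HasSubgaussianMGF (fun z => F θ z - ∫ ξ, F θ ξ ∂(D i)) (1 / 4) (D i) := by
    intro i
    convert hasSubgaussianMGF_of_mem_Icc (μ := D i) (a := 0) (b := 1) hm.aemeasurable
      (ae_of_all _ fun z => hF01 θ z) using 1
    simp
    norm_num
  have h2 := hasSubgaussianMGF_sum_pi fun i : Fin n =>
    hasSubgaussianMGF_sum_pi fun _ : Fin (s i) => h1 i
  have h3 := h2.const_mul (-(totalSize s : ℝ)⁻¹)
  have hN : (totalSize s : NNReal) ≠ 0 := by exact_mod_cast hs.ne'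
  have hc : (⟨(-(totalSize s : ℝ)⁻¹) ^ 2, sq_nonneg _⟩ * ∑ i, ∑ _j : Fin (s i), (1 / 4) : NNReal)
      = 1 / (4 * totalSize s) := by
    have : (∑ i, ∑ _j : Fin (s i), (1 / 4) : NNReal) = totalSize s / 4 := by
      simp [totalSize, div_eq_mul_inv, Finset.sum_mul]
    rw [this]
    apply NNReal.eq
    push_cast
    change (-(totalSize s : ℝ)⁻¹) ^ 2 * ((totalSize s : ℝ) / 4) = 1 / (4 * totalSize s)
    have : (totalSize s : ℝ) ≠ 0 := by exact_mod_cast hs.ne'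
    field_simp
  rw [hc] at h3
  refine h3.congr (ae_of_all _ fun S => ?_)
  simp only [gap, integral_globalLaw hF hF01 hD, Finset.sum_sub_distrib]
  ring

/-- The exponential moment of the squared generalization gap, averaged over a prior. -/
lemma lintegral_lintegral_exp_gap_le (hF : Measurable (Function.uncurry F))
    (hF01 : ∀ θ z, F θ z ∈ Set.Icc (0 : ℝ) 1) (hD : ∀ i, IsProbabilityMeasure (D i))
    (hs : 0 < totalSize s) (P : Measure (EuclideanSpace ℝ (Fin d))) [IsProbabilityMeasure P] :
    ∫⁻ S, ∫⁻ θ, ENNReal.ofReal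
        (Real.exp ((2 * totalSize s - 1) * gap F D θ S ^ 2)) ∂P ∂(dataLaw s D) ≤
      ENNReal.ofReal (Real.sqrt (2 * totalSize s)) := by
  have hN : (1 : ℝ) ≤ totalSize s := by exact_mod_cast hs
  have : IsProbabilityMeasure (dataLaw s D) := by unfold dataLaw; infer_instance
  rw [lintegral_lintegral_swap]
  · calc _ ≤ ∫⁻ _θ, ENNReal.ofReal (Real.sqrt (2 * totalSize s)) ∂P := by
          refine lintegral_mono fun θ => ?_
          -- With c = 2N - 1 and v = 1/(4N) one gets 1 - 2cv = 1/(2N): just subcritical, and the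
          -- source of √(2N).
          have hv : (2 * totalSize s - 1) * ((1 / (4 * totalSize s) : NNReal) : ℝ) =
              (1 - 1 / (2 * totalSize s)) / 2 := by
            push_cast
            field_simp
            ring
          refine (lintegral_exp_mul_sq_le
            (hasSubgaussianMGF_gap hF hF01 hD hs θ) (by linarith) ?_).trans_eq ?_
          · rw [hv]
            have : (0 : ℝ) < 1 / (2 * totalSize s) := by positivity
            linarith
          · rw [hv, one_div, ← Real.sqrt_inv]
            congr 2
            field_simp
            ring
      _ = _ := by simp
  · have := (measurable_gap (F := F) hF hs hD)
    exact (ENNReal.measurable_ofReal.comp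
      (Real.measurable_exp.comp ((this.pow_const 2).const_mul _))).aemeasurable

end Gap

end FedPAC

namespace FedPAC

/-! ### A Gaussian variational inequality -/

section Density

variable {E : Type*} [NormedAddCommGroup E] [InnerProductSpace ℝ E] [FiniteDimensional ℝ E]
  [MeasurableSpace E] [BorelSpace E]

lemma integrable_exp_neg_half_norm_sq :
    Integrable fun v : E => Real.exp (-(1 / 2) * ‖v‖ ^ 2) := by
  have h := (GaussianFourier.integrable_cexp_neg_mul_sq_norm_add (V := E) (b := 1 / 2)
    (by norm_num) 0 0).norm
  refine h.congr (ae_of_all _ fun v => ?_)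
  simp only [zero_mul, add_zero, Complex.norm_exp]
  congr 1
  have : (-(1 / 2) * (‖v‖ : ℂ) ^ 2) = ((-(1 / 2) * ‖v‖ ^ 2 : ℝ) : ℂ) := by push_cast; ring
  rw [this, Complex.ofReal_re]

variable (E) in
/-- The density of the standard Gaussian distribution. -/
noncomputable def stdGaussianDensity (v : E) : ℝ :=
  (∫ w : E, Real.exp (-(1 / 2) * ‖w‖ ^ 2))⁻¹ * Real.exp (-(1 / 2) * ‖v‖ ^ 2)

lemma stdGaussianDensity_nonneg (v : E) : 0 ≤ stdGaussianDensity E v :=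
  mul_nonneg (inv_nonneg.2 (integral_nonneg fun _ => (Real.exp_pos _).le)) (Real.exp_pos _).le

lemma measurable_stdGaussianDensity : Measurable (stdGaussianDensity E) := by
  unfold stdGaussianDensity
  fun_prop

lemma integrable_stdGaussianDensity : Integrable (stdGaussianDensity E) :=
  integrable_exp_neg_half_norm_sq.const_mul _

/-- Both measures are finite and have the same characteristic function, by the Fourier transform of
the Gaussian; the normalizing constant cancels. -/
lemma stdGaussian_eq_withDensity :
    stdGaussian E = volume.withDensity fun v => ENNReal.ofReal (stdGaussianDensity E v) := by
  have : IsFiniteMeasure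
      ((volume : Measure E).withDensity fun v => ENNReal.ofReal (stdGaussianDensity E v)) :=
    isFiniteMeasure_withDensity_ofReal integrable_stdGaussianDensity.2
  apply Measure.ext_of_charFun
  ext t
  have hI : ((∫ w : E, Real.exp (-(1 / 2) * ‖w‖ ^ 2) : ℝ) : ℂ) =
      (Real.pi / (1 / 2 : ℂ)) ^ (Module.finrank ℝ E / 2 : ℂ) := by
    rw [← GaussianFourier.integral_cexp_neg_mul_sq_norm (V := E) (b := 1 / 2) (by norm_num),
      ← integral_complex_ofReal]
    congr 1
    ext v
    push_cast
    ring_nf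
  have hne : (Real.pi / (1 / 2 : ℂ)) ^ (Module.finrank ℝ E / 2 : ℂ) ≠ 0 := by
    rw [Complex.cpow_def_of_ne_zero (by simp [Real.pi_ne_zero])]
    exact Complex.exp_ne_zero _
  rw [charFun_stdGaussian, charFun_apply, integral_withDensity_eq_integral_toReal_smul
    measurable_stdGaussianDensity.ennreal_ofReal (by simp)]
  have h : ∀ x : E, (ENNReal.ofReal (stdGaussianDensity E x)).toReal •
      Complex.exp (inner ℝ x t * Complex.I) =
      ((∫ w : E, Real.exp (-(1 / 2) * ‖w‖ ^ 2) : ℝ) : ℂ)⁻¹ *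
        Complex.exp (-(1 / 2) * ‖x‖ ^ 2 + Complex.I * inner ℝ t x) := by
    intro x
    rw [ENNReal.toReal_ofReal (stdGaussianDensity_nonneg x), stdGaussianDensity, Complex.exp_add,
      Complex.real_smul, real_inner_comm]
    push_cast
    ring_nf
  simp_rw [h]
  rw [integral_const_mul,
    GaussianFourier.integral_cexp_neg_mul_sq_norm_add (by norm_num) Complex.I t, hI, ← mul_assoc,
    inv_mul_cancel₀ hne, one_mul, Complex.I_sq]
  congr 1
  ring

lemma integral_stdGaussian_eq (g : E → ℝ) :
    ∫ x, g x ∂(stdGaussian E) = ∫ x, stdGaussianDensity E x * g x := by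
  rw [stdGaussian_eq_withDensity, integral_withDensity_eq_integral_toReal_smul
    measurable_stdGaussianDensity.ennreal_ofReal (by simp)]
  simp_rw [ENNReal.toReal_ofReal (stdGaussianDensity_nonneg _), smul_eq_mul]

lemma integrable_stdGaussian_iff (g : E → ℝ) :
    Integrable g (stdGaussian E) ↔ Integrable fun x => stdGaussianDensity E x * g x := by
  rw [stdGaussian_eq_withDensity, integrable_withDensity_iff_integrable_smul'
    measurable_stdGaussianDensity.ennreal_ofReal (by simp)]
  simp_rw [ENNReal.toReal_ofReal (stdGaussianDensity_nonneg _), smul_eq_mul]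

/-- Change of variables by a linear map under the standard Gaussian distribution. -/
lemma integral_stdGaussian_linear (f : E →L[ℝ] E) (hf : LinearMap.det (f : E →ₗ[ℝ] E) ≠ 0)
    {g : E → ℝ} (hg : Integrable g (stdGaussian E)) :
    Integrable (fun z => g (f z) * Real.exp (1 / 2 * ‖z‖ ^ 2 - 1 / 2 * ‖f z‖ ^ 2))
      (stdGaussian E) ∧
    ∫ y, g y ∂(stdGaussian E) = |LinearMap.det (f : E →ₗ[ℝ] E)| *
      ∫ z, g (f z) * Real.exp (1 / 2 * ‖z‖ ^ 2 - 1 / 2 * ‖f z‖ ^ 2) ∂(stdGaussian E) := by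
  have hmap := Measure.map_linearMap_addHaar_eq_smul_addHaar (volume : Measure E) hf
  rw [integrable_stdGaussian_iff] at hg ⊢
  have hfm : AEMeasurable (f : E →ₗ[ℝ] E) (volume : Measure E) := f.continuous.measurable.aemeasurable
  have hg' := hg.smul_measure (c := ENNReal.ofReal |(LinearMap.det (f : E →ₗ[ℝ] E))⁻¹|) (by simp)
  rw [← hmap] at hg'
  -- The exponential factor is the ratio of the Gaussian densities at `f z` and at `z`.
  have key : ∀ z, stdGaussianDensity E z *
      (g (f z) * Real.exp (1 / 2 * ‖z‖ ^ 2 - 1 / 2 * ‖f z‖ ^ 2)) =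
      stdGaussianDensity E (f z) * g (f z) := by
    intro z
    have : Real.exp (-(1 / 2) * ‖f z‖ ^ 2) = Real.exp (-(1 / 2) * ‖z‖ ^ 2) *
        Real.exp (1 / 2 * ‖z‖ ^ 2 - 1 / 2 * ‖f z‖ ^ 2) := by
      rw [← Real.exp_add]
      ring_nf
    rw [stdGaussianDensity, stdGaussianDensity, this]
    ring
  rw [integral_stdGaussian_eq, integral_stdGaussian_eq]
  simp_rw [key]
  refine ⟨hg'.comp_aemeasurable hfm, ?_⟩
  have h2 : ∫ z, stdGaussianDensity E (f z) * g (f z) = _ :=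
    (integral_map hfm hg'.aestronglyMeasurable).symm
  rw [h2, hmap, integral_smul_measure, ENNReal.toReal_ofReal (abs_nonneg _), abs_inv, smul_eq_mul,
    ← mul_assoc, mul_inv_cancel₀ (abs_ne_zero.2 hf), one_mul]

end Density

/-! ### Donsker–Varadhan for Gaussians with a common mean -/

section Variational

variable {ι : Type*} [Fintype ι] [DecidableEq ι]

lemma integral_norm_sq_multivariateGaussian {S : Matrix ι ι ℝ} (hS : S.PosSemidef) :
    ∫ x, ‖x‖ ^ 2 ∂(multivariateGaussian 0 S) = S.trace := by
  have hL : ∀ i : ι, MemLp (fun x : EuclideanSpace ℝ ι => x i) 2 (multivariateGaussian 0 S) := by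
    intro i
    exact (EuclideanSpace.proj i : EuclideanSpace ℝ ι →L[ℝ] ℝ).comp_memLp'
      (IsGaussian.memLp_two_id (μ := multivariateGaussian 0 S))
  simp_rw [EuclideanSpace.real_norm_sq_eq]
  rw [integral_finsetSum _ fun i _ => (hL i).integrable_sq]
  refine Finset.sum_congr rfl fun i _ => ?_
  rw [Matrix.diag_apply, ← variance_eval_multivariateGaussian (μ := 0) hS i, variance_of_integral_eq_zero]
  · fun_prop
  · have := ContinuousLinearMap.integral_comp_id_comm (μ := multivariateGaussian 0 S)
      IsGaussian.integrable_id (EuclideanSpace.proj i : EuclideanSpace ℝ ι →L[ℝ] ℝ)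
    simpa using this

lemma integral_norm_sq_stdGaussian :
    ∫ x, ‖x‖ ^ 2 ∂(stdGaussian (EuclideanSpace ℝ ι)) = Fintype.card ι := by
  rw [← multivariateGaussian_zero_one, integral_norm_sq_multivariateGaussian Matrix.PosSemidef.one,
    Matrix.trace_one]

open scoped MatrixOrder in
/-- The Donsker–Varadhan inequality for two Gaussian distributions with the same mean, the second
of which has identity covariance; the entropy term is explicit. -/
lemma integral_multivariateGaussian_le (c : EuclideanSpace ℝ ι) {S : Matrix ι ι ℝ}
    (hS : S.PosDef) {h : EuclideanSpace ℝ ι → ℝ} (hm : Measurable h) {M : ℝ}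
    (hM : ∀ x, h x ∈ Set.Icc 0 M) :
    ∫ x, h x ∂(multivariateGaussian c S) ≤
      (S.trace - Fintype.card ι - Real.log S.det) / 2 +
        Real.log (∫ x, Real.exp (h x) ∂(multivariateGaussian c 1)) := by
  set γ := stdGaussian (EuclideanSpace ℝ ι)
  -- The square root of `S` carries the standard Gaussian to N(0, S), so both sides become integrals
  -- against `γ`.
  set f := Matrix.toEuclideanCLM (𝕜 := ℝ) (CFC.sqrt S) with hf
  have hsq : CFC.sqrt S * CFC.sqrt S = S := CFC.sqrt_mul_sqrt_self S hS.posSemidef.nonneg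
  have hdet : (CFC.sqrt S).det * (CFC.sqrt S).det = S.det := by rw [← Matrix.det_mul, hsq]
  have hdet0 : (CFC.sqrt S).det ≠ 0 := fun h0 => hS.det_pos.ne' (by rw [← hdet, h0, zero_mul])
  have hfdet : LinearMap.det (f : EuclideanSpace ℝ ι →ₗ[ℝ] EuclideanSpace ℝ ι) =
      (CFC.sqrt S).det := by
    rw [hf, Matrix.coe_toEuclideanCLM_eq_toEuclideanLin,
      show Matrix.toEuclideanLin (CFC.sqrt S) = Matrix.toLpLin 2 2 (CFC.sqrt S) from rfl,
      Matrix.toLpLin_eq_toLin, LinearMap.det_toLin]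
  have hlog : Real.log |(CFC.sqrt S).det| = Real.log S.det / 2 := by
    rw [Real.log_abs, ← hdet, Real.log_mul hdet0 hdet0]
    ring
  have e1 : ∫ x, h x ∂(multivariateGaussian c S) = ∫ z, h (c + f z) ∂γ := by
    rw [multivariateGaussian, integral_map (by fun_prop) hm.aestronglyMeasurable]
  have e2 : ∫ x, Real.exp (h x) ∂(multivariateGaussian c 1) = ∫ y, Real.exp (h (c + y)) ∂γ := by
    rw [multivariateGaussian, integral_map (by fun_prop) (by fun_prop)]
    simp [γ]
  have e3 : ∫ z, ‖f z‖ ^ 2 ∂γ = S.trace := by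
    rw [← integral_norm_sq_multivariateGaussian hS.posSemidef, multivariateGaussian,
      integral_map (by fun_prop) (by fun_prop)]
    simp [γ, hf]
  have hid : MemLp (fun z => z) 2 γ := IsGaussian.memLp_two_id
  have i1 : Integrable (fun z => ‖z‖ ^ 2) γ := hid.integrable_norm_pow (by norm_num)
  have i2 : Integrable (fun z => ‖f z‖ ^ 2) γ :=
    (f.comp_memLp' hid).integrable_norm_pow (by norm_num)
  have i3 : Integrable (fun z => h (c + f z)) γ :=
    Integrable.of_mem_Icc 0 M (by fun_prop) (ae_of_all _ fun z => hM _)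
  have i4 : Integrable (fun y => Real.exp (h (c + y))) γ :=
    Integrable.of_mem_Icc 0 (Real.exp M) (by fun_prop)
      (ae_of_all _ fun z => ⟨(Real.exp_pos _).le, Real.exp_le_exp.2 (hM _).2⟩)
  obtain ⟨i5, e5⟩ := integral_stdGaussian_linear f (hfdet ▸ hdet0) i4
  simp_rw [← Real.exp_add] at i5 e5
  have i6 : Integrable (fun z => h (c + f z) + (1 / 2 * ‖z‖ ^ 2 - 1 / 2 * ‖f z‖ ^ 2)) γ :=
    i3.add ((i1.const_mul _).sub (i2.const_mul _))
  -- The change of variables rewrites the exponential moment as |det f| times the integral of exp(h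
  -- + ½‖z‖² - ½‖f z‖²). Jensen bounds that integral below; the mean of the quadratic terms and log
  -- |det f| = ½ log det S make up the divergence.
  have jensen := convexOn_exp.map_integral_le (μ := γ) Real.continuous_exp.continuousOn isClosed_univ
    (ae_of_all _ fun _ => Set.mem_univ _) i6 i5
  have e6 : ∫ z, h (c + f z) + (1 / 2 * ‖z‖ ^ 2 - 1 / 2 * ‖f z‖ ^ 2) ∂γ =
      ∫ x, h x ∂(multivariateGaussian c S) + (1 / 2 * Fintype.card ι - 1 / 2 * S.trace) := by
    rw [integral_add i3 (show Integrable (fun z => 1 / 2 * ‖z‖ ^ 2 - 1 / 2 * ‖f z‖ ^ 2) γ from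
      (i1.const_mul _).sub (i2.const_mul _)), integral_sub (i1.const_mul _) (i2.const_mul _), integral_const_mul, integral_const_mul, e3, e1,
      integral_norm_sq_stdGaussian]
  have hpos := (Real.exp_pos _).trans_le jensen
  have hl := Real.log_le_log (Real.exp_pos _) jensen
  rw [Real.log_exp, e6] at hl
  rw [e2, e5, Real.log_mul (abs_ne_zero.2 (hfdet ▸ hdet0)) hpos.ne', hfdet, hlog]
  linarith

end Variational

end FedPAC

namespace FedPAC

/-! ### Stationary distributions of Ornstein–Uhlenbeck processes -/

open Matrix Filter Topology

/-! ### Noise covariance in an eigenbasis of the drift -/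

section Diagonalization

variable {d : ℕ} {A U : Matrix (Fin d) (Fin d) ℝ} {l : Fin d → ℝ}

lemma exists_diagonalization (hA : A.PosDef) :
    ∃ (U : Matrix (Fin d) (Fin d) ℝ) (l : Fin d → ℝ), U * Uᵀ = 1 ∧ (∀ i, 0 < l i) ∧
      A = U * diagonal l * Uᵀ := by
  refine ⟨hA.isHermitian.eigenvectorUnitary, hA.isHermitian.eigenvalues, ?_,
    hA.eigenvalues_pos, ?_⟩
  · have := Unitary.mul_star_self_of_mem hA.isHermitian.eigenvectorUnitary.2
    rwa [star_eq_conjTranspose, conjTranspose_eq_transpose_of_trivial] at this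
  · conv_lhs => rw [hA.isHermitian.spectral_theorem]
    rw [Unitary.conjStarAlgAut_apply, star_eq_conjTranspose, conjTranspose_eq_transpose_of_trivial]
    rfl

lemma exp_smul_eq_conj (hU : U * Uᵀ = 1) (hA : A = U * diagonal l * Uᵀ) (r : ℝ) :
    NormedSpace.exp (r • A) = U * diagonal (fun i => Real.exp (r * l i)) * Uᵀ := by
  have hinv : U⁻¹ = Uᵀ := inv_eq_right_inv hU
  have hunit : IsUnit U := IsUnit.of_mul_eq_one _ hU
  have : r • A = U * diagonal (fun i => r * l i) * U⁻¹ := by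
    rw [hA, hinv, ← smul_mul_assoc, ← mul_smul_comm, ← diagonal_smul]
    rfl
  rw [this, exp_conj _ _ hunit, exp_diagonal, hinv]
  congr 3
  ext i
  rw [Pi.coe_exp, Real.exp_eq_exp_ℝ]

/-- The conjugate by `U` of `Uᵀ C U` with entries weighted by `w`. -/
def weightedConj (U C : Matrix (Fin d) (Fin d) ℝ) (w : Fin d → Fin d → ℝ) :
    Matrix (Fin d) (Fin d) ℝ :=
  U * of (fun i j => w i j * (Uᵀ * C * U) i j) * Uᵀ

lemma weightedConj_apply (U C : Matrix (Fin d) (Fin d) ℝ) (w : Fin d → Fin d → ℝ) (i j : Fin d) :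
    weightedConj U C w i j = ∑ b, ∑ a, (U i a * (Uᵀ * C * U) a b * U j b) * w a b := by
  rw [weightedConj, Matrix.mul_apply]
  refine Finset.sum_congr rfl fun b _ => ?_
  rw [Matrix.mul_apply, Finset.sum_mul]
  refine Finset.sum_congr rfl fun a _ => ?_
  rw [of_apply, transpose_apply U b j]
  ring

/-- In the eigenbasis the exponential is diagonal, so conjugation rescales each entry of Uᵀ C U
separately. Matrix integrals and limits in time then reduce to scalar ones. -/
lemma exp_mul_mul_exp_transpose (hU : U * Uᵀ = 1) (hA : A = U * diagonal l * Uᵀ)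
    (C : Matrix (Fin d) (Fin d) ℝ) (r : ℝ) :
    NormedSpace.exp (r • A) * C * (NormedSpace.exp (r • A))ᵀ =
      weightedConj U C fun i j => Real.exp (r * (l i + l j)) := by
  rw [exp_smul_eq_conj hU hA, weightedConj]
  have : (of fun i j => Real.exp (r * (l i + l j)) * (Uᵀ * C * U) i j) =
      diagonal (fun i => Real.exp (r * l i)) * (Uᵀ * C * U) *
        diagonal (fun i => Real.exp (r * l i)) := by
    ext i j
    rw [mul_diagonal, diagonal_mul, of_apply, mul_add, Real.exp_add]
    ring
  rw [this]
  simp only [transpose_mul, transpose_transpose, diagonal_transpose, Matrix.mul_assoc]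

lemma ouNoiseCov_eq_weightedConj (hU : U * Uᵀ = 1) (hl : ∀ i, 0 < l i)
    (hA : A = U * diagonal l * Uᵀ) (G : Matrix (Fin d) (Fin d) ℝ) (t : ℝ) :
    ouNoiseCov A G t = weightedConj U (G * Gᵀ)
      fun i j => (1 - Real.exp (-t * (l i + l j))) / (l i + l j) := by
  ext i j
  simp only [ouNoiseCov, of_apply, exp_mul_mul_exp_transpose hU hA, weightedConj_apply]
  rw [intervalIntegral.integral_finsetSum fun b _ => by
    refine Continuous.intervalIntegrable ?_ _ _; fun_prop]
  refine Finset.sum_congr rfl fun b _ => ?_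
  rw [intervalIntegral.integral_finsetSum fun b _ => by
    refine Continuous.intervalIntegrable ?_ _ _; fun_prop]
  refine Finset.sum_congr rfl fun a _ => ?_
  rw [intervalIntegral.integral_const_mul]
  congr 1
  have hab : l a + l b ≠ 0 := (add_pos (hl a) (hl b)).ne'
  have hderiv : ∀ u ∈ Set.uIcc 0 t, HasDerivAt
      (fun u : ℝ => Real.exp (-(t - u) * (l a + l b)) / (l a + l b))
      (Real.exp (-(t - u) * (l a + l b))) u := by
    intro u _
    have h1 : HasDerivAt (fun u : ℝ => -(t - u) * (l a + l b)) (l a + l b) u := by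
      simpa using (((hasDerivAt_id u).const_sub t).neg.mul_const (l a + l b))
    have h2 := h1.exp.div_const (l a + l b)
    rwa [mul_div_cancel_right₀ _ hab] at h2
  rw [intervalIntegral.integral_eq_sub_of_hasDerivAt hderiv
    (Continuous.intervalIntegrable (by fun_prop) _ _)]
  simp [sub_div]

lemma tendsto_exp_neg_smul (hU : U * Uᵀ = 1) (hl : ∀ i, 0 < l i)
    (hA : A = U * diagonal l * Uᵀ) :
    Tendsto (fun t : ℝ => NormedSpace.exp (-t • A)) atTop (𝓝 0) := by
  simp only [exp_smul_eq_conj hU hA]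
  have h : Tendsto (fun t : ℝ => diagonal fun i => Real.exp (-t * l i)) atTop (𝓝 0) := by
    refine tendsto_pi_nhds.2 fun i => tendsto_pi_nhds.2 fun j => ?_
    rcases eq_or_ne i j with rfl | hij
    · simp only [diagonal_apply_eq, Matrix.zero_apply]
      exact Real.tendsto_exp_atBot.comp
        (tendsto_neg_atTop_atBot.atBot_mul_const (hl i))
    · simp [diagonal_apply_ne _ hij]
  simpa using (h.const_mul U).mul_const Uᵀ

lemma tendsto_ouNoiseCov (hU : U * Uᵀ = 1) (hl : ∀ i, 0 < l i)
    (hA : A = U * diagonal l * Uᵀ) (G : Matrix (Fin d) (Fin d) ℝ) :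
    Tendsto (ouNoiseCov A G) atTop
      (𝓝 (weightedConj U (G * Gᵀ) fun i j => 1 / (l i + l j))) := by
  refine tendsto_pi_nhds.2 fun i => tendsto_pi_nhds.2 fun j => ?_
  simp only [ouNoiseCov_eq_weightedConj hU hl hA, weightedConj_apply]
  refine tendsto_finsetSum _ fun b _ => tendsto_finsetSum _ fun a _ => Tendsto.const_mul _ ?_
  have h : Tendsto (fun t : ℝ => Real.exp (-t * (l a + l b))) atTop (𝓝 0) :=
    Real.tendsto_exp_atBot.comp
      (tendsto_neg_atTop_atBot.atBot_mul_const (add_pos (hl a) (hl b)))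
  simpa using (h.const_sub 1).div_const (l a + l b)

/-- The trace sees only the diagonal weights 1/(2 lᵢ), which are half the eigenvalues of A⁻¹. Hence
`C` need not commute with `A`. -/
lemma trace_weightedConj (hU : U * Uᵀ = 1) (hl : ∀ i, 0 < l i)
    (hA : A = U * diagonal l * Uᵀ) (C : Matrix (Fin d) (Fin d) ℝ) :
    (weightedConj U C fun i j => 1 / (l i + l j)).trace = (C * A⁻¹).trace / 2 := by
  have hU' : Uᵀ * U = 1 := mul_eq_one_comm.1 hU
  have hAinv : A⁻¹ = U * diagonal (fun i => (l i)⁻¹) * Uᵀ := by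
    refine inv_eq_right_inv ?_
    have h1 : diagonal l * diagonal (fun i => (l i)⁻¹) = 1 := by
      rw [diagonal_mul_diagonal, ← diagonal_one]
      congr 1
      ext i
      exact mul_inv_cancel₀ (hl i).ne'
    calc A * (U * diagonal (fun i => (l i)⁻¹) * Uᵀ)
        = U * (diagonal l * (Uᵀ * U) * diagonal (fun i => (l i)⁻¹)) * Uᵀ := by
          rw [hA]; simp only [Matrix.mul_assoc]
      _ = 1 := by rw [hU', Matrix.mul_one, h1, Matrix.mul_one, hU]
  rw [hAinv, weightedConj, trace_mul_cycle, hU', Matrix.one_mul, ← Matrix.mul_assoc,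
    trace_mul_comm, ← Matrix.mul_assoc, ← Matrix.mul_assoc, trace, trace, Finset.sum_div]
  refine Finset.sum_congr rfl fun i _ => ?_
  rw [diag_apply, diag_apply, mul_diagonal, of_apply]
  have := (hl i).ne'
  field_simp
  ring

lemma posSemidef_ouNoiseCov (hU : U * Uᵀ = 1) (hA : A = U * diagonal l * Uᵀ)
    (G : Matrix (Fin d) (Fin d) ℝ) {t : ℝ} (ht : 0 ≤ t) : (ouNoiseCov A G t).PosSemidef := by
  set K : ℝ → Matrix (Fin d) (Fin d) ℝ := fun u => NormedSpace.exp (-(t - u) • A) *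
    (G * Gᵀ) * (NormedSpace.exp (-(t - u) • A))ᵀ with hK
  have hpsd : ∀ u, (K u).PosSemidef := fun u => by
    have h : (G * Gᵀ).PosSemidef := by
      simpa [conjTranspose_eq_transpose_of_trivial] using posSemidef_self_mul_conjTranspose G
    simpa only [hK, conjTranspose_eq_transpose_of_trivial] using
      h.mul_mul_conjTranspose_same (NormedSpace.exp (-(t - u) • A))
  have hcont : ∀ i j, Continuous fun u => K u i j := fun i j => by
    simp only [hK, exp_mul_mul_exp_transpose hU hA, weightedConj_apply]
    fun_prop
  have hint : ∀ i j, ouNoiseCov A G t i j = ∫ u in (0 : ℝ)..t, K u i j := fun i j => rfl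
  refine PosSemidef.of_dotProduct_mulVec_nonneg (IsHermitian.ext fun i j => ?_) fun x => ?_
  · rw [hint, hint, star_trivial]
    congr 1
    ext u
    exact (hpsd u).isHermitian.apply i j
  · have : star x ⬝ᵥ ouNoiseCov A G t *ᵥ x = ∫ u in (0 : ℝ)..t, star x ⬝ᵥ K u *ᵥ x := by
      simp only [dotProduct, mulVec, hint, Finset.mul_sum]
      rw [intervalIntegral.integral_finsetSum fun b _ => by
        refine Continuous.intervalIntegrable ?_ _ _; fun_prop]
      refine Finset.sum_congr rfl fun i _ => ?_
      rw [intervalIntegral.integral_finsetSum fun b _ => by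
        refine Continuous.intervalIntegrable ?_ _ _; fun_prop]
      refine Finset.sum_congr rfl fun j _ => ?_
      rw [intervalIntegral.integral_const_mul, intervalIntegral.integral_mul_const]
    rw [this]
    exact intervalIntegral.integral_nonneg ht fun u _ => (hpsd u).dotProduct_mulVec_nonneg x

end Diagonalization

variable {d : ℕ}

lemma posSemidef_of_tendsto {α : Type*} {f : Filter α} [f.NeBot]
    {M : α → Matrix (Fin d) (Fin d) ℝ} {S : Matrix (Fin d) (Fin d) ℝ} (hM : Tendsto M f (𝓝 S))
    (hpsd : ∀ᶠ a in f, (M a).PosSemidef) : S.PosSemidef := by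
  refine PosSemidef.of_dotProduct_mulVec_nonneg ?_ fun x => ?_
  · have h : Tendsto (fun a => (M a)ᴴ) f (𝓝 Sᴴ) :=
      ((continuous_id.matrix_conjTranspose).tendsto S).comp hM
    refine tendsto_nhds_unique (h.congr' ?_) hM
    filter_upwards [hpsd] with a ha using ha.isHermitian
  · have hc : Continuous fun M : Matrix (Fin d) (Fin d) ℝ => star x ⬝ᵥ M *ᵥ x :=
      continuous_const.dotProduct (continuous_id.matrix_mulVec continuous_const)
    refine ge_of_tendsto ((hc.tendsto S).comp hM) ?_
    filter_upwards [hpsd] with a ha using ha.dotProduct_mulVec_nonneg x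

/-- Independence of the initial value and the noise factors the characteristic function, and taking
the adjoint moves the matrix exponential onto `ξ`. -/
lemma charFun_ouLaw (c : EuclideanSpace ℝ (Fin d)) (A G : Matrix (Fin d) (Fin d) ℝ)
    (Q : Measure (EuclideanSpace ℝ (Fin d))) [IsProbabilityMeasure Q] {t : ℝ}
    (hS : (ouNoiseCov A G t).PosSemidef) (ξ : EuclideanSpace ℝ (Fin d)) :
    charFun (ouLaw c A G Q t) ξ =
      Complex.exp ((inner ℝ c ξ - inner ℝ c
          (Matrix.toEuclideanCLM (𝕜 := ℝ) (NormedSpace.exp (-t • A))ᵀ ξ) : ℝ) * Complex.I) *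
        charFun Q (Matrix.toEuclideanCLM (𝕜 := ℝ) (NormedSpace.exp (-t • A))ᵀ ξ) *
        Complex.exp (-(ξ ⬝ᵥ ouNoiseCov A G t *ᵥ ξ : ℝ) / 2) := by
  set E := NormedSpace.exp (-t • A)
  have hadj : ∀ x : EuclideanSpace ℝ (Fin d),
      inner ℝ (Matrix.toEuclideanCLM (𝕜 := ℝ) E x) ξ =
        inner ℝ x (Matrix.toEuclideanCLM (𝕜 := ℝ) Eᵀ ξ) := by
    intro x
    rw [real_inner_comm, inner_toEuclideanCLM, inner_toEuclideanCLM, dotProduct_mulVec,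
      dotProduct_comm, mulVec_transpose]
  rw [charFun_apply, ouLaw, integral_map (by fun_prop) (by fun_prop)]
  have h : ∀ p : EuclideanSpace ℝ (Fin d) × EuclideanSpace ℝ (Fin d),
      Complex.exp ((inner ℝ (c + Matrix.toEuclideanCLM (𝕜 := ℝ) E (p.1 - c) + p.2) ξ : ℝ) *
        Complex.I) =
      Complex.exp ((inner ℝ c ξ - inner ℝ c (Matrix.toEuclideanCLM (𝕜 := ℝ) Eᵀ ξ) : ℝ) *
          Complex.I) *
        (Complex.exp ((inner ℝ p.1 (Matrix.toEuclideanCLM (𝕜 := ℝ) Eᵀ ξ) : ℝ) * Complex.I) *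
          Complex.exp ((inner ℝ p.2 ξ : ℝ) * Complex.I)) := by
    intro p
    rw [inner_add_left, inner_add_left, hadj, inner_sub_left, ← Complex.exp_add, ← Complex.exp_add]
    push_cast
    ring_nf
  rw [integral_congr_ae (ae_of_all _ h), integral_const_mul, integral_prod_mul
    (fun x => Complex.exp ((inner ℝ x (Matrix.toEuclideanCLM (𝕜 := ℝ) Eᵀ ξ) : ℝ) * Complex.I))
    (fun x => Complex.exp ((inner ℝ x ξ : ℝ) * Complex.I)), ← charFun_apply, ← charFun_apply,
    charFun_multivariateGaussian hS, mul_assoc]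
  congr 3
  rw [inner_zero_right]
  push_cast
  ring

/-- A stationary distribution of an Ornstein–Uhlenbeck process with positive definite drift is
Gaussian, and the trace of its covariance matrix is explicit. -/
theorem IsOUStationary.exists_eq_multivariateGaussian {c : EuclideanSpace ℝ (Fin d)}
    {A G : Matrix (Fin d) (Fin d) ℝ} (hA : A.PosDef) {Q : Measure (EuclideanSpace ℝ (Fin d))}
    (hQ : IsOUStationary c A G Q) :
    ∃ S : Matrix (Fin d) (Fin d) ℝ, S.PosSemidef ∧ Q = multivariateGaussian c S ∧
      S.trace = (G * Gᵀ * A⁻¹).trace / 2 := by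
  obtain ⟨U, l, hU, hl, hAU⟩ := exists_diagonalization hA
  have hQprob := hQ.1
  have hlim := tendsto_ouNoiseCov hU hl hAU G
  have hpsd : ∀ᶠ t in atTop, (ouNoiseCov A G t).PosSemidef := by
    filter_upwards [eventually_ge_atTop 0] with t ht using posSemidef_ouNoiseCov hU hAU G ht
  have hS := posSemidef_of_tendsto hlim hpsd
  refine ⟨_, hS, ?_, trace_weightedConj hU hl hAU _⟩
  set S := weightedConj U (G * Gᵀ) fun i j => 1 / (l i + l j)
  apply Measure.ext_of_charFun
  ext ξ
  -- The initial law is forgotten: its characteristic function is evaluated at a point tending to 0,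
  -- where it equals 1.
  have he : Tendsto (fun t : ℝ =>
      Matrix.toEuclideanCLM (𝕜 := ℝ) (NormedSpace.exp (-t • A))ᵀ ξ) atTop (𝓝 0) := by
    have hc : Continuous fun M : Matrix (Fin d) (Fin d) ℝ =>
        Matrix.toEuclideanCLM (𝕜 := ℝ) Mᵀ ξ := by
      have : ∀ M : Matrix (Fin d) (Fin d) ℝ,
          Matrix.toEuclideanCLM (𝕜 := ℝ) Mᵀ ξ = WithLp.toLp 2 (Mᵀ *ᵥ ξ.ofLp) := fun M => rfl
      simp_rw [this]
      exact (PiLp.continuous_toLp 2 _).comp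
        (continuous_id.matrix_transpose.matrix_mulVec continuous_const)
    simpa [Function.comp_def] using (hc.tendsto 0).comp (tendsto_exp_neg_smul hU hl hAU)
  have hc2 : Continuous fun M : Matrix (Fin d) (Fin d) ℝ =>
      Complex.exp (-(ξ ⬝ᵥ M *ᵥ ξ : ℝ) / 2) := by
    have : Continuous fun M : Matrix (Fin d) (Fin d) ℝ => ξ.ofLp ⬝ᵥ M *ᵥ ξ.ofLp :=
      continuous_const.dotProduct (continuous_id.matrix_mulVec continuous_const)
    fun_prop
  have hc1 : Continuous fun y : EuclideanSpace ℝ (Fin d) =>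
      Complex.exp ((inner ℝ c ξ - inner ℝ c y : ℝ) * Complex.I) * charFun Q y :=
    (by fun_prop : Continuous fun y : EuclideanSpace ℝ (Fin d) =>
      Complex.exp ((inner ℝ c ξ - inner ℝ c y : ℝ) * Complex.I)).mul continuous_charFun
  have hright := ((hc1.tendsto 0).comp he).mul ((hc2.tendsto S).comp hlim)
  have hleft : Tendsto (fun _ : ℝ => charFun Q ξ) atTop (𝓝 (charFun Q ξ)) := tendsto_const_nhds
  rw [charFun_multivariateGaussian hS]
  -- By stationarity the left side is constant in t, so it equals the limit of the right side, which
  -- is the Gaussian characteristic function.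
  refine (tendsto_nhds_unique (hleft.congr' ?_) hright).trans ?_
  · filter_upwards [eventually_ge_atTop 0] with t ht
    conv_lhs => rw [← hQ.2 t ht]
    exact charFun_ouLaw c A G Q (posSemidef_ouNoiseCov hU hAU G ht) ξ
  · rw [inner_zero_right, charFun_zero, sub_zero, probReal_univ, Complex.ofReal_one, mul_one,
      ← Complex.exp_add, real_inner_comm]
    congr 1
    push_cast
    ring

end FedPAC

namespace FedPAC

/-! ### The generalization bound -/

lemma covMat_multivariateGaussian {d : ℕ} (c : EuclideanSpace ℝ (Fin d))
    {S : Matrix (Fin d) (Fin d) ℝ} (hS : S.PosSemidef) :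
    covMat (multivariateGaussian c S) = S := by
  ext i j
  exact covariance_eval_multivariateGaussian hS i j

lemma posDef_clientAvg {n d : ℕ} {A : Fin n → Matrix (Fin d) (Fin d) ℝ}
    (hA : ∀ i, (A i).PosSemidef) (hinv : IsUnit (clientAvg A)) : (clientAvg A).PosDef := by
  refine Matrix.PosSemidef.posDef_iff_isUnit ?_ |>.2 hinv
  exact (Matrix.posSemidef_sum _ fun i _ => hA i).smul (by positivity)

/-- A stationary distribution of the federated SGD process is Gaussian, and the trace of its
covariance matrix is explicit. -/
lemma IsFedStationary.exists_eq_multivariateGaussian {n d : ℕ}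
    {θstar : EuclideanSpace ℝ (Fin d)} {T : ℕ} (hT : 1 ≤ T) {η k m : ℝ} (hη : 0 < η)
    (hkm : 0 < k * m) {A B : Fin n → Matrix (Fin d) (Fin d) ℝ} (hA : ∀ i, (A i).PosSemidef)
    (hinv : IsUnit (clientAvg A)) {Q : Measure (EuclideanSpace ℝ (Fin d))}
    (hQ : IsFedStationary θstar T η k m A B Q) :
    ∃ S : Matrix (Fin d) (Fin d) ℝ, S.PosSemidef ∧ Q = multivariateGaussian θstar S ∧
      S.trace = T * η / (2 * (k * m)) * (avgNoiseCov B * (clientAvg A)⁻¹).trace := by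
  have hT0 : (0 : ℝ) < T := by exact_mod_cast hT
  obtain ⟨S, hS, hQS, htr⟩ :=
    IsOUStationary.exists_eq_multivariateGaussian ((posDef_clientAvg hA hinv).smul hT0) hQ
  refine ⟨S, hS, hQS, htr.trans ?_⟩
  have hinv' : ((T : ℝ) • clientAvg A)⁻¹ = (T : ℝ)⁻¹ • (clientAvg A)⁻¹ := by
    refine Matrix.inv_eq_right_inv ?_
    rw [smul_mul_smul_comm, mul_inv_cancel₀ hT0.ne', one_smul,
      Matrix.mul_nonsing_inv _ ((Matrix.isUnit_iff_isUnit_det _).1 hinv)]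
  rw [hinv', Matrix.transpose_smul, smul_mul_smul_comm, smul_mul_smul_comm, Matrix.trace_smul,
    smul_eq_mul, ← avgNoiseCov]
  -- The noise contributes T² and the inverse drift 1/T, leaving a single factor T in the trace.
  have hsq : (T * Real.sqrt (η / (k * m))) * (T * Real.sqrt (η / (k * m))) =
      T ^ 2 * (η / (k * m)) := by
    rw [mul_mul_mul_comm, Real.mul_self_sqrt (by positivity)]
    ring
  rw [hsq]
  field_simp

lemma avgSize_pos {n : ℕ} {s : Fin n → ℕ} (hs : 0 < totalSize s) : 0 < avgSize s := by
  have hn : 0 < n := by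
    rcases Nat.eq_zero_or_pos n with rfl | h
    · simp [totalSize] at hs
    · exact h
  have h1 : (0 : ℝ) < ∑ i, (s i : ℝ) := by exact_mod_cast hs
  exact div_pos h1 (by exact_mod_cast hn)

/-! ### PAC-Bayes: risk bound on the good event, and its probability -/

section PACBayes

variable {n d : ℕ} {s : Fin n → ℕ} {Z : Type*} [MeasurableSpace Z]
  {F : EuclideanSpace ℝ (Fin d) → Z → ℝ} {D : Fin n → Measure Z}

lemma risk_sub_empRisk (hF : Measurable (Function.uncurry F))
    (hF01 : ∀ θ z, F θ z ∈ Set.Icc (0 : ℝ) 1) (hD : ∀ i, IsProbabilityMeasure (D i))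
    (hs : 0 < totalSize s) (S : Dataset s Z) (Q : Measure (EuclideanSpace ℝ (Fin d)))
    [IsProbabilityMeasure Q] :
    risk F (globalLaw s D) Q - empRisk F S Q = ∫ θ, gap F D θ S ∂Q := by
  have := isProbabilityMeasure_globalLaw hs hD
  have hemp : Integrable (fun θ => (∑ i, ∑ j, F θ (S i j)) / (totalSize s : ℝ)) Q :=
    (integrable_finsetSum _ fun i _ => integrable_finsetSum _ fun j _ =>
      Integrable.of_mem_Icc 0 1 hF.of_uncurry_right.aemeasurable
        (ae_of_all _ fun θ => hF01 θ _)).div_const _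
  have hgap : Integrable (fun θ => gap F D θ S) Q :=
    Integrable.of_mem_Icc (-1) 1
      ((measurable_gap (F := F) hF hs hD).comp measurable_prodMk_left).aemeasurable
      (ae_of_all _ fun θ => gap_mem_Icc hF hF01 hD hs θ S)
  have hrisk : risk F (globalLaw s D) Q = ∫ θ, (gap F D θ S +
      (∑ i, ∑ j, F θ (S i j)) / (totalSize s : ℝ)) ∂Q := by
    simp only [risk, gap, sub_add_cancel]
  rw [hrisk, integral_add hgap hemp, empRisk, add_sub_cancel_right]

/-- The PAC-Bayes inequality with Gaussian prior, on the event that the exponential moment of the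
squared gap is small, for a Gaussian posterior with the same mean. -/
lemma risk_sub_empRisk_le (hF : Measurable (Function.uncurry F))
    (hF01 : ∀ θ z, F θ z ∈ Set.Icc (0 : ℝ) 1) (hD : ∀ i, IsProbabilityMeasure (D i))
    (hs : 0 < totalSize s) {θstar : EuclideanSpace ℝ (Fin d)} {C : Matrix (Fin d) (Fin d) ℝ}
    (hC : C.PosDef) (S : Dataset s Z) {δ : ℝ} (hδ : 0 < δ)
    (hS : ∫⁻ θ, ENNReal.ofReal (Real.exp ((2 * totalSize s - 1) * gap F D θ S ^ 2))
      ∂(multivariateGaussian θstar 1) ≤ ENNReal.ofReal (Real.sqrt (2 * totalSize s) / δ)) :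
    risk F (globalLaw s D) (multivariateGaussian θstar C) -
        empRisk F S (multivariateGaussian θstar C) ≤
      Real.sqrt ((-Real.log C.det + C.trace - d + 2 * Real.log (1 / δ)
        + 2 * Real.log (totalSize s) + 4) / (4 * totalSize s - 2)) := by
  have hN : (1 : ℝ) ≤ totalSize s := by exact_mod_cast hs
  set N : ℝ := ((totalSize s : ℕ) : ℝ)
  have hgm : Measurable fun θ => gap F D θ S :=
    (measurable_gap (F := F) hF hs hD).comp measurable_prodMk_left
  have hg := fun θ => gap_mem_Icc hF hF01 hD hs θ S
  have hg2 : ∀ θ, gap F D θ S ^ 2 ∈ Set.Icc (0 : ℝ) 1 := fun θ =>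
    ⟨sq_nonneg _, (sq_le_one_iff_abs_le_one _).2 (abs_le.2 (hg θ))⟩
  have hh : ∀ θ, (2 * N - 1) * gap F D θ S ^ 2 ∈ Set.Icc 0 (2 * N - 1) := fun θ =>
    ⟨mul_nonneg (by linarith) (hg2 θ).1, mul_le_of_le_one_right (by linarith) (hg2 θ).2⟩
  have hhm : Measurable fun θ => (2 * N - 1) * gap F D θ S ^ 2 := (hgm.pow_const 2).const_mul _
  have hvar := integral_multivariateGaussian_le θstar hC hhm hh
  have hexp : Integrable (fun θ => Real.exp ((2 * N - 1) * gap F D θ S ^ 2))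
      (multivariateGaussian θstar 1) :=
    Integrable.of_mem_Icc 0 (Real.exp (2 * N - 1)) hhm.exp.aemeasurable
      (ae_of_all _ fun θ => ⟨(Real.exp_pos _).le, Real.exp_le_exp.2 (hh θ).2⟩)
  rw [← ofReal_integral_eq_lintegral_ofReal hexp (ae_of_all _ fun θ => (Real.exp_pos _).le),
    ENNReal.ofReal_le_ofReal_iff (by positivity)] at hS
  have hlog := Real.log_le_log (integral_exp_pos hexp) hS
  have hlog2 : Real.log (Real.sqrt (2 * N) / δ) =
      (Real.log 2 + Real.log N) / 2 + Real.log (1 / δ) := by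
    rw [div_eq_mul_one_div, Real.log_mul (by positivity) (by positivity), Real.log_sqrt (by positivity),
      Real.log_mul (by norm_num) (by positivity)]
  -- After doubling, the moment bound contributes log 2 + log N, which is relaxed to the stated 4 +
  -- 2 log N.
  have hl2 : Real.log 2 ≤ 1 := by linarith [Real.log_le_sub_one_of_pos (zero_lt_two' ℝ)]
  have hlN : 0 ≤ Real.log N := Real.log_nonneg hN
  have hjensen := (Even.convexOn_pow (𝕜 := ℝ) even_two).map_integral_le
    (μ := multivariateGaussian θstar C) (f := fun θ => gap F D θ S)
    (continuous_pow 2).continuousOn isClosed_univ (ae_of_all _ fun _ => Set.mem_univ _)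
    (Integrable.of_mem_Icc (-1) 1 hgm.aemeasurable (ae_of_all _ hg))
    (Integrable.of_mem_Icc 0 1 (hgm.pow_const 2).aemeasurable (ae_of_all _ hg2))
  rw [integral_const_mul, Fintype.card_fin] at hvar
  rw [risk_sub_empRisk hF hF01 hD hs]
  refine (le_abs_self _).trans (Real.abs_le_sqrt ?_)
  rw [le_div_iff₀ (by linarith)]
  have := mul_le_mul_of_nonneg_left hjensen (show 0 ≤ 2 * N - 1 by linarith)
  linarith

/-- With high probability, the exponential moment of the squared gap under a prior that does not
depend on the data is small. -/
lemma exists_measurableSet_lintegral_exp_gap_le (hF : Measurable (Function.uncurry F))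
    (hF01 : ∀ θ z, F θ z ∈ Set.Icc (0 : ℝ) 1) (hD : ∀ i, IsProbabilityMeasure (D i))
    (hs : 0 < totalSize s) (P : Measure (EuclideanSpace ℝ (Fin d))) [IsProbabilityMeasure P]
    {δ : ℝ} (hδ : 0 < δ) :
    ∃ E : Set (Dataset s Z), MeasurableSet E ∧ ENNReal.ofReal (1 - δ) ≤ dataLaw s D E ∧
      ∀ S ∈ E, ∫⁻ θ, ENNReal.ofReal (Real.exp ((2 * totalSize s - 1) * gap F D θ S ^ 2)) ∂P ≤
        ENNReal.ofReal (Real.sqrt (2 * totalSize s) / δ) := by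
  have hN : (1 : ℝ) ≤ totalSize s := by exact_mod_cast hs
  have : IsProbabilityMeasure (dataLaw s D) := by unfold dataLaw; infer_instance
  set V : Dataset s Z → ENNReal := fun S =>
    ∫⁻ θ, ENNReal.ofReal (Real.exp ((2 * totalSize s - 1) * gap F D θ S ^ 2)) ∂P
  have hVm : Measurable V := by
    refine Measurable.lintegral_prod_right'
      (f := fun p : Dataset s Z × EuclideanSpace ℝ (Fin d) =>
        ENNReal.ofReal (Real.exp ((2 * totalSize s - 1) * gap F D p.2 p.1 ^ 2))) ?_
    exact (((measurable_gap (F := F) hF hs hD).pow_const 2).const_mul _).exp.ennreal_ofReal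
  set ε := ENNReal.ofReal (Real.sqrt (2 * totalSize s) / δ)
  have hε : ε ≠ 0 := by
    rw [ne_eq, ENNReal.ofReal_eq_zero, not_le]
    positivity
  have hbad : MeasurableSet {S | ε ≤ V S} := measurableSet_le measurable_const hVm
  refine ⟨{S | ε ≤ V S}ᶜ, hbad.compl, ?_, fun S hS => (not_le.1 (show ¬ε ≤ V S from hS)).le⟩
  have hmarkov : dataLaw s D {S | ε ≤ V S} ≤ ENNReal.ofReal δ := by
    refine (meas_ge_le_lintegral_div hVm.aemeasurable hε ENNReal.ofReal_ne_top).trans ?_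
    refine (ENNReal.div_le_div_right (lintegral_lintegral_exp_gap_le hF hF01 hD hs P) _).trans ?_
    rw [← ENNReal.ofReal_div_of_pos (by positivity)]
    refine ENNReal.ofReal_le_ofReal (le_of_eq ?_)
    have : Real.sqrt (2 * totalSize s) ≠ 0 := by positivity
    field_simp
  rw [prob_compl_eq_one_sub hbad, ENNReal.ofReal_sub _ hδ.le, ENNReal.ofReal_one]
  exact tsub_le_tsub_left hmarkov 1

end PACBayes

end FedPAC

theorem mainTheorem4 {Z : Type*} [MeasurableSpace Z] (n d : ℕ)
    -- local data set sizes and client data distributions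
    (s : Fin n → ℕ) (hs : 0 < FedPAC.totalSize s)
    (D : Fin n → Measure Z) (hD : ∀ i, IsProbabilityMeasure (D i))
    -- loss function
    (F : EuclideanSpace ℝ (Fin d) → Z → ℝ)
    (hF : Measurable (Function.uncurry F)) (hF01 : ∀ θ z, F θ z ∈ Set.Icc (0 : ℝ) 1)
    -- minimum, number of rounds, learning rate, batch fraction
    (θstar : EuclideanSpace ℝ (Fin d))
    (T : ℕ) (hT : 1 ≤ T) (η : ℝ) (hη : 0 < η)
    (k : ℝ) (hk : 1 / FedPAC.avgSize s ≤ k) (hk1 : k ≤ 1)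
    -- local Hessians and noise factors, and the output distribution, all depending on the data
    (A B : FedPAC.Dataset s Z → Fin n → Matrix (Fin d) (Fin d) ℝ)
    (Q : FedPAC.Dataset s Z → Measure (EuclideanSpace ℝ (Fin d)))
    (hA : ∀ᵐ S ∂(FedPAC.dataLaw s D), ∀ i, (A S i).PosSemidef)
    (hAinv : ∀ᵐ S ∂(FedPAC.dataLaw s D), IsUnit (FedPAC.clientAvg (A S)))
    (hQ : ∀ᵐ S ∂(FedPAC.dataLaw s D),
      FedPAC.IsFedStationary θstar T η k (FedPAC.avgSize s) (A S) (B S) (Q S))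
    (hSigma : ∀ᵐ S ∂(FedPAC.dataLaw s D), IsUnit (FedPAC.covMat (Q S)))
    (δ : ℝ) (hδ : 0 < δ) (hδ1 : δ < 1) :
    ∃ E : Set (FedPAC.Dataset s Z), MeasurableSet E ∧
      ENNReal.ofReal (1 - δ) ≤ FedPAC.dataLaw s D E ∧
      ∀ S ∈ E,
        FedPAC.risk F (FedPAC.globalLaw s D) (Q S) - FedPAC.empRisk F S (Q S) ≤
          Real.sqrt
            ((-Real.log (FedPAC.covMat (Q S)).det
                + (T : ℝ) * η / (2 * (k * FedPAC.avgSize s))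
                  * (FedPAC.avgNoiseCov (B S) * (FedPAC.clientAvg (A S))⁻¹).trace
                - (d : ℝ) + 2 * Real.log (1 / δ)
                + 2 * Real.log (FedPAC.totalSize s : ℝ) + 4)
              / (4 * (FedPAC.totalSize s : ℝ) - 2)) := by
  obtain ⟨E₁, hE₁, hμ, hE₁'⟩ := FedPAC.exists_measurableSet_lintegral_exp_gap_le (s := s) hF hF01 hD
    hs (multivariateGaussian θstar 1) hδ
  -- The dependence of `A`, `B`, `Q` on the data need not be measurable, so the almost sure
  -- assumptions are restricted to a measurable set of full measure.
  obtain ⟨E₂, hE₂μ, hE₂, hE₂'⟩ := (hA.and (hAinv.and (hQ.and hSigma))).exists_measurable_mem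
  refine ⟨E₁ ∩ E₂, hE₁.inter hE₂, ?_, ?_⟩
  · rw [measure_inter_conull (mem_ae_iff.1 hE₂μ)]
    exact hμ
  · rintro S ⟨hS₁, hS₂⟩
    obtain ⟨hAS, hinv, hstat, hcov⟩ := hE₂' S hS₂
    have hm := FedPAC.avgSize_pos hs
    have hk0 : 0 < k := (one_div_pos.2 hm).trans_le hk
    obtain ⟨C, hC, hQC, htr⟩ := hstat.exists_eq_multivariateGaussian hT hη (mul_pos hk0 hm) hAS hinv
    rw [hQC, FedPAC.covMat_multivariateGaussian θstar hC] at hcov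
    rw [hQC, FedPAC.covMat_multivariateGaussian θstar hC, ← htr]
    exact FedPAC.risk_sub_empRisk_le hF hF01 hD hs (hC.posDef_iff_isUnit.2 hcov) S hδ
      (hE₁' S hS₁)
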